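/- Let $d\ge 1$, let $|\cdot|$ be any norm on $\mathbb R^d$ with closed balls $B(\xi,\rho)$, let $\lambda_d$ be Lebesgue measure, and let $p\in(0,\infty)$. For a probability measure $\mu$ on $\mathbb R^d$, $q\in(0,\infty)$ and $\Gamma\subset\mathbb R^d$ put $$e_q(\Gamma,\mu)=\Big(\int_{\mathbb R^d} d(\xi,\Gamma)^q\,\mu(d\xi)\Big)^{1/q}\in[0,\infty],\qquad d(\xi,\Gamma)=\inf_{a\in\Gamma}|\xi-a| .$$ For a sequence $(a_N)_{N\ge1}$ in $\mathbb R^d$ write $a^{(N)}=\{a_1,\dots,a_N\}$, $a^{(0)}=\emptyset$. The sequence is called a greedy $L^p$-optimal sequence for $\mu$ if, for every $N\ge0$, $a_{N+1}$ minimizes $\xi\mapsto e_p(a^{(N)}\cup\{\xi\},\mu)$ over $\mathbb R^d$; it is called $L^q$-rate optimal if $\limsup_N N^{1/d}e_q(a^{(N)},\mu)<+\infty$. Assume that $\mu=\varphi\cdot\lambda_d$ for a Borel function $\varphi:\mathbb R^d\to[0,\infty)$, that $\int|\xi|^{p+\delta}\mu(d\xi)<+\infty$ for some $\delta>0$, and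 that $\mathrm{supp}(\mu)$ is peakless in the following sense: there is $c>0$ with $$\inf\Big\{\frac{\lambda_d(\mathrm{supp}(\mu)\cap B(\xi,\rho))}{\lambda_d(B(\xi,\rho))}\ :\ \xi\in\mathrm{supp}(\mu),\ 0<\rho\le c|\xi|\Big\}>0 .$$ For $\varepsilon\ge0$, say that $\varphi$ satisfies the local growth control $(G_\varepsilon)$ if there are $\eta\in(0,\frac12)$ and $M,C>0$ such that $$\forall\,\xi,\xi'\in\mathrm{supp}(\mu),\quad |\xi|\ge M,\ |\xi'-\xi|\le2\eta|\xi|\ \Longrightarrow\ \varphi(\xi')\ge C\,\varphi(\xi)^{1+\varepsilon}.$$ (a) Let $\varepsilon\ge0$ and assume $(G_\varepsilon)$. Then, for every $q\in\big(0,\frac{p+d}{1+\varepsilon}\big)$ such that $$\int_{\{\varphi>0\}}\varphi^{1-\frac{q(1+\varepsilon)}{p+d}}\,d\lambda_d<+\infty,$$ every greedy $L^p$-optimal sequence for $\mu$ is $L^q$-rate optimal. (b) Assume that $(G_0)$ holds, or that there is $\underline\varepsilon>0$ such that $(G_\varepsilon)$ holds for every $\varepsilon\in(0,\underline\varepsilon]$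 (with constants $\eta,M,C$ that may depend on $\varepsilon$). If moreover $\int_{\{\varphi>0\}}\varphi^{1-\frac{q}{p+d}}\,d\lambda_d<+\infty$ for every $q\in(0,p+d)$, then every greedy $L^p$-optimal sequence for $\mu$ is $L^q$-rate optimal for every $q\in(p,p+d)$. -/

import Mathlib

open MeasureTheory Filter
open scoped ENNReal

namespace GreedyQuantization

noncomputable section

/-- The `L^p`-mean quantization error `e_p(Γ, μ) = (∫ d(ξ, Γ)^p μ(dξ))^(1/p)` of the set `Γ` for the
distribution `μ`, with values in `[0, ∞]`. -/
def quantError {E : Type*} [NormedAddCommGroup E] [MeasurableSpace E]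
    (p : ℝ) (μ : Measure E) (Γ : Set E) : ℝ≥0∞ :=
  (∫⁻ ξ, Metric.infEDist ξ Γ ^ p ∂μ) ^ (1 / p)

/-- The grid made of the first `N` terms of a sequence; the sequence is indexed from `0`, so that
`a 0, a 1, …` are the points `a₁, a₂, …`. -/
def grid {E : Type*} (a : ℕ → E) (N : ℕ) : Set E := a '' Set.Iio N

/-- `a` is an `L^p`-optimal greedy quantization sequence for `μ`: every new point minimizes, over
the whole space, the `L^p`-mean quantization error of the grid obtained by adding one point to the
previous ones. -/
def IsGreedyOptimal {E : Type*} [NormedAddCommGroup E] [MeasurableSpace E]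
    (p : ℝ) (μ : Measure E) (a : ℕ → E) : Prop :=
  ∀ (N : ℕ) (ξ : E),
    quantError p μ (grid a N ∪ {a N}) ≤ quantError p μ (grid a N ∪ {ξ})

/-- `L^q`-rate optimality: `limsup_N N^(1/d) e_q(a^(N), μ) < ∞`, where `d` is the dimension. -/
def IsRateOptimal {E : Type*} [NormedAddCommGroup E] [NormedSpace ℝ E] [MeasurableSpace E]
    (q : ℝ) (μ : Measure E) (a : ℕ → E) : Prop :=
  limsup (fun N : ℕ => (N : ℝ≥0∞) ^ (1 / (Module.finrank ℝ E : ℝ)) * quantError q μ (grid a N))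
    atTop < ∞

/-- The support of `μ` is peakless: for some `c > 0`, the proportion of a ball `B(ξ, ρ)` occupied by
the support is bounded below, uniformly over the points `ξ` of the support and `0 < ρ ≤ c |ξ|`. -/
def IsPeakless {E : Type*} [NormedAddCommGroup E] [MeasurableSpace E]
    (lam μ : Measure E) : Prop :=
  ∃ c : ℝ, 0 < c ∧
    0 < ⨅ ξ ∈ μ.support, ⨅ ρ ∈ Set.Ioc (0 : ℝ) (c * ‖ξ‖),
      lam (μ.support ∩ Metric.closedBall ξ ρ) / lam (Metric.closedBall ξ ρ)

/-- The local growth control assumption with exponent `1 + ε` on the density `φ` of `μ`. -/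
def LocalGrowthControl {E : Type*} [NormedAddCommGroup E] [MeasurableSpace E]
    (μ : Measure E) (φ : E → ℝ) (ε : ℝ) : Prop :=
  ∃ η M C : ℝ, 0 < η ∧ η < 1 / 2 ∧ 0 < M ∧ 0 < C ∧
    ∀ ξ ∈ μ.support, ∀ ξ' ∈ μ.support, M ≤ ‖ξ‖ → ‖ξ' - ξ‖ ≤ 2 * η * ‖ξ‖ →
      C * φ ξ ^ (1 + ε) ≤ φ ξ'

end

end GreedyQuantization

namespace GreedyQuantization

/-! ### Distortion and the mean gain of a random point. -/

section Distortion

variable {E : Type*} [NormedAddCommGroup E] [MeasurableSpace E]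

/-! Write `D_q(N)` for the integral of the `q`-th power of the distance to the grid of size `N`. A
greedy point does at least as well as a random one. Averaging the comparison over `y` drawn from a
finite measure `ν` bounds `D_p(N) - D_p(N+1)` below by a multiple of `∫ ν(B(ξ, c δ)) δ^p dμ`, where
`δ` is the distance from `ξ` to the grid. If `ν(B(ξ, c ρ)) ≥ g(ξ) ρ^d` for the relevant radii, this
dominates `∫ g δ^(p+d) dμ`, and the reverse Hölder inequality yields `D_q(N)^((p+d)/q) ≤ K (D_p(N) -
D_p(N+1))` as soon as `g^(-q/(p+d-q))` is `μ`-integrable (`IsGreedyOptimal.distortion_rpow_le`).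

This is used twice. For `q = p` and `ν` with density `(1+|x|)^(-r)`, the moment of order above `p`
gives the integrability; the recursion closes on `D_p` and gives `D_p(N) = O(N^(-p/d))`. For general
`q`, `ν` has density `φ^(1-u)`, `u = q(1+ε)/(p+d)`, plus a polynomial density. Far from the origin,
growth control and peaklessness allow `g` of order `φ^((1+ε)(1-u))`. The integral of `φ^(1-u)`
serves both to make `ν` finite and to control the negative power of `g`. Summing decrements from `n`
to `2n` gives `n D_q(2n)^((p+d)/q) ≤ K D_p(n)`, and the `L^p` rate of `D_p(n)` turns this into the
`L^q` rate. Part (b) is part (a) with `ε` small. -/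

/-- The `p`-th power of the quantization error. -/
noncomputable def distortion (p : ℝ) (μ : Measure E) (Γ : Set E) : ℝ≥0∞ :=
  ∫⁻ ξ, Metric.infEDist ξ Γ ^ p ∂μ

lemma distortion_anti {p : ℝ} (hp : 0 < p) (μ : Measure E) {Γ Γ' : Set E} (h : Γ ⊆ Γ') :
    distortion p μ Γ' ≤ distortion p μ Γ :=
  lintegral_mono fun _ => ENNReal.rpow_le_rpow (Metric.infEDist_anti h) hp.le

omit [NormedAddCommGroup E] [MeasurableSpace E] in
lemma grid_mono (a : ℕ → E) {m n : ℕ} (h : m ≤ n) : grid a m ⊆ grid a n :=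
  Set.image_mono fun _ hk => lt_of_lt_of_le hk h

omit [NormedAddCommGroup E] [MeasurableSpace E] in
lemma grid_succ (a : ℕ → E) (N : ℕ) : grid a (N + 1) = grid a N ∪ {a N} := by
  ext x
  simp only [grid, Set.mem_image, Set.mem_Iio, Set.mem_union, Set.mem_singleton_iff]
  constructor
  · rintro ⟨k, hk, rfl⟩
    rcases Nat.lt_succ_iff_lt_or_eq.1 hk with h | rfl
    · exact Or.inl ⟨k, h, rfl⟩
    · exact Or.inr rfl
  · rintro (⟨k, hk, rfl⟩ | rfl)
    · exact ⟨k, by omega, rfl⟩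
    · exact ⟨N, by omega, rfl⟩

lemma IsGreedyOptimal.distortion_le {p : ℝ} (hp : 0 < p) {μ : Measure E} {a : ℕ → E}
    (ha : IsGreedyOptimal p μ a) (N : ℕ) (ξ : E) :
    distortion p μ (grid a (N + 1)) ≤ distortion p μ (grid a N ∪ {ξ}) := by
  rw [grid_succ]
  exact (ENNReal.rpow_le_rpow_iff (by positivity)).1 (ha N ξ)

/-- Rate optimality from a bound on the powers of the distortion. -/
lemma isRateOptimal_of_mul_distortion_le [NormedSpace ℝ E] [FiniteDimensional ℝ E] [Nontrivial E]
    {q : ℝ} {μ : Measure E} {a : ℕ → E} {K : ℝ≥0∞} (hK : K ≠ ∞)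
    (h : ∀ᶠ N : ℕ in atTop,
      (N : ℝ≥0∞) * distortion q μ (grid a N) ^ ((Module.finrank ℝ E : ℝ) / q) ≤ K) :
    IsRateOptimal q μ a := by
  have hd : 0 < (Module.finrank ℝ E : ℝ) := by exact_mod_cast Module.finrank_pos
  refine lt_of_le_of_lt (limsup_le_of_le (a := K ^ (1 / (Module.finrank ℝ E : ℝ)))
    (by isBoundedDefault) ?_) (ENNReal.rpow_lt_top_of_nonneg (by positivity) hK)
  filter_upwards [h] with N hN
  have := ENNReal.rpow_le_rpow hN (z := 1 / (Module.finrank ℝ E : ℝ)) (by positivity)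
  rw [ENNReal.mul_rpow_of_nonneg _ _ (by positivity), ← ENNReal.rpow_mul] at this
  rwa [show (Module.finrank ℝ E : ℝ) / q * (1 / (Module.finrank ℝ E : ℝ)) = 1 / q by
    field_simp] at this

variable [BorelSpace E]

/-- The gain of an optimal additional point, compared with the mean gain of a random point. -/
lemma lintegral_measure_mul_infEDist_rpow_le [SecondCountableTopology E] {p : ℝ} (hp : 0 < p)
    {c : ℝ≥0∞} (hc : c < 1) {μ ν : Measure E} [SFinite μ] [SFinite ν] {Γ : Set E} {D : ℝ≥0∞}
    (hD : D ≠ ∞) (h : ∀ y, D ≤ distortion p μ (Γ ∪ {y})) :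
    (1 - c ^ p) * ∫⁻ ξ, ν {y | edist y ξ ≤ c * Metric.infEDist ξ Γ} * Metric.infEDist ξ Γ ^ p ∂μ ≤
      ν Set.univ * (distortion p μ Γ - D) := by
  have hcp : c ^ p ≤ 1 := ENNReal.rpow_le_one hc.le hp.le
  set S : Set (E × E) := {z | edist z.2 z.1 ≤ c * Metric.infEDist z.1 Γ} with hS
  have hSm : MeasurableSet S := by
    refine measurableSet_le (measurable_edist.comp measurable_swap) ?_
    exact (measurable_infEDist.comp measurable_fst).const_mul c
  have hmeas : Measurable fun z : E × E =>
      S.indicator (fun z => (1 - c ^ p) * Metric.infEDist z.1 Γ ^ p) z :=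
    (((measurable_infEDist.comp measurable_fst).pow_const p).const_mul _).indicator hSm
  have key : ∀ y, ∫⁻ ξ, S.indicator (fun z => (1 - c ^ p) * Metric.infEDist z.1 Γ ^ p) (ξ, y) ∂μ
      ≤ distortion p μ Γ - D := by
    intro y
    refine ENNReal.le_sub_of_add_le_left hD ?_
    refine (add_le_add_left (h y) _).trans ?_
    unfold distortion
    rw [← lintegral_add_left (measurable_infEDist.pow_const p)]
    refine lintegral_mono fun ξ => ?_
    dsimp only
    rw [Metric.infEDist_union, Metric.infEDist_singleton]
    by_cases hz : (ξ, y) ∈ S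
    · rw [Set.indicator_of_mem hz]
      -- On `S`, adding `y` shrinks the distance by a factor at least `c`, a gain of `(1 - c^p)`
      -- times its `p`-th power.
      have h1 : (Metric.infEDist ξ Γ ⊓ edist ξ y) ^ p ≤ c ^ p * Metric.infEDist ξ Γ ^ p := by
        rw [← ENNReal.mul_rpow_of_nonneg _ _ hp.le]
        refine ENNReal.rpow_le_rpow (inf_le_right.trans ?_) hp.le
        rw [edist_comm]; exact hz
      calc _ ≤ c ^ p * Metric.infEDist ξ Γ ^ p + (1 - c ^ p) * Metric.infEDist ξ Γ ^ p := by
            gcongr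
        _ = _ := by rw [← add_mul, add_tsub_cancel_of_le hcp, one_mul]
    · rw [Set.indicator_of_notMem hz, add_zero]
      exact ENNReal.rpow_le_rpow inf_le_left hp.le
  calc _ = ∫⁻ ξ, ∫⁻ y, S.indicator (fun z => (1 - c ^ p) * Metric.infEDist z.1 Γ ^ p) (ξ, y) ∂ν ∂μ := by
        rw [← lintegral_const_mul' _ _ (by finiteness)]
        refine lintegral_congr fun ξ => ?_
        have : ∀ y, S.indicator (fun z => (1 - c ^ p) * Metric.infEDist z.1 Γ ^ p) (ξ, y) =
          {y | edist y ξ ≤ c * Metric.infEDist ξ Γ}.indicator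
            (fun _ => (1 - c ^ p) * Metric.infEDist ξ Γ ^ p) y := fun y => rfl
        simp_rw [this]
        rw [lintegral_indicator_const (measurableSet_le
          (f := fun y => edist y ξ) (measurable_id.edist measurable_const) measurable_const)]
        ring
    _ = ∫⁻ y, ∫⁻ ξ, S.indicator (fun z => (1 - c ^ p) * Metric.infEDist z.1 Γ ^ p) (ξ, y) ∂μ ∂ν :=
        lintegral_lintegral_swap hmeas.aemeasurable
    _ ≤ ∫⁻ _, (distortion p μ Γ - D) ∂ν := lintegral_mono key
    _ = _ := by rw [lintegral_const, mul_comm]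

end Distortion

/-! ### Reverse Hölder and recursive inequalities for sequences. -/

/-- Reverse Hölder inequality. -/
lemma lintegral_rpow_le_of_weight {α : Type*} [MeasurableSpace α] (μ : Measure α) {q t : ℝ}
    (hq : 0 < q) (hqt : q < t) {f g : α → ℝ≥0∞} (hf : Measurable f) (hg : Measurable g)
    (hg0 : ∀ᵐ x ∂μ, g x ≠ 0) (hg1 : ∀ᵐ x ∂μ, g x ≠ ∞) :
    (∫⁻ x, f x ^ q ∂μ) ^ (t / q) ≤
      (∫⁻ x, g x ^ (-(q / (t - q))) ∂μ) ^ ((t - q) / q) * ∫⁻ x, g x * f x ^ t ∂μ := by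
  have ht : 0 < t := hq.trans hqt
  have htq : 0 < t - q := sub_pos.2 hqt
  have hconj : (t / q).HolderConjugate (t / (t - q)) := by
    rw [Real.holderConjugate_iff]
    refine ⟨(one_lt_div hq).2 hqt, ?_⟩
    field_simp
    ring
  have hH := ENNReal.lintegral_mul_le_Lp_mul_Lq μ hconj
    (f := fun x => g x ^ (q / t) * f x ^ q) (g := fun x => g x ^ (-(q / t)))
    (by fun_prop) (by fun_prop)
  have e1 : ∫⁻ x, ((fun x => g x ^ (q / t) * f x ^ q) * fun x => g x ^ (-(q / t))) x ∂μ =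
      ∫⁻ x, f x ^ q ∂μ := by
    refine lintegral_congr_ae ?_
    filter_upwards [hg0, hg1] with x h0 h1
    simp only [Pi.mul_apply]
    rw [mul_right_comm, ← ENNReal.rpow_add _ _ h0 h1, add_neg_cancel, ENNReal.rpow_zero, one_mul]
  have e2 : ∫⁻ x, (g x ^ (q / t) * f x ^ q) ^ (t / q) ∂μ = ∫⁻ x, g x * f x ^ t ∂μ := by
    refine lintegral_congr fun x => ?_
    rw [ENNReal.mul_rpow_of_nonneg _ _ (by positivity), ← ENNReal.rpow_mul, ← ENNReal.rpow_mul]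
    congr 1
    · rw [show q / t * (t / q) = 1 by field_simp, ENNReal.rpow_one]
    · congr 1; field_simp
  have e3 : ∫⁻ x, (g x ^ (-(q / t))) ^ (t / (t - q)) ∂μ = ∫⁻ x, g x ^ (-(q / (t - q))) ∂μ := by
    refine lintegral_congr fun x => ?_
    rw [← ENNReal.rpow_mul]
    congr 1; field_simp
  rw [e1, e2, e3] at hH
  have := ENNReal.rpow_le_rpow hH (z := t / q) (by positivity)
  rw [ENNReal.mul_rpow_of_nonneg _ _ (by positivity), ← ENNReal.rpow_mul, ← ENNReal.rpow_mul,
    show 1 / (t / q) * (t / q) = 1 by field_simp, ENNReal.rpow_one, mul_comm] at this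
  convert this using 3
  field_simp

/-- Sequences whose decrements dominate a power of order `1 + r` decay like `N ^ (-1 / r)`. -/
lemma mul_rpow_le_of_rpow_le_sub {r C : ℝ} (hr : 0 < r) {x : ℕ → ℝ}
    (hx : ∀ n, 0 ≤ x n) (h : ∀ n, C * x n ^ (1 + r) ≤ x n - x (n + 1)) (n : ℕ) :
    r * C * n * x n ^ r ≤ 1 := by
  induction n with
  | zero => simp
  | succ n ih =>
    have h0 := Real.rpow_nonneg (hx n) r
    rcases le_or_gt C 0 with hC | hC
    · have : r * C * (n + 1 : ℕ) * x (n + 1) ^ r ≤ 0 :=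
        mul_nonpos_of_nonpos_of_nonneg (mul_nonpos_of_nonpos_of_nonneg
          (mul_nonpos_of_nonneg_of_nonpos hr.le hC) (by positivity)) (Real.rpow_nonneg (hx _) r)
      linarith
    have h1 : x (n + 1) ≤ x n * Real.exp (-(C * x n ^ r)) := by
      have h2 := h n
      rw [Real.rpow_one_add' (hx n) (by positivity)] at h2
      have h3 := mul_le_mul_of_nonneg_left (Real.add_one_le_exp (-(C * x n ^ r))) (hx n)
      linarith
    have h4 : x (n + 1) ^ r ≤ x n ^ r * Real.exp (-(r * C * x n ^ r)) := by
      refine (Real.rpow_le_rpow (hx _) h1 hr.le).trans_eq ?_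
      rw [Real.mul_rpow (hx n) (Real.exp_pos _).le, ← Real.exp_mul]
      ring_nf
    set y := r * C * x n ^ r with hy
    -- The induction hypothesis reads `n y ≤ 1`, so `(n + 1) y ≤ 1 + y`.
    have h5 : (n + 1) * y ≤ Real.exp y := by
      have := Real.add_one_le_exp y
      linarith
    calc r * C * (n + 1 : ℕ) * x (n + 1) ^ r
        ≤ r * C * (n + 1 : ℕ) * (x n ^ r * Real.exp (-y)) := by gcongr
      _ = (n + 1) * y * Real.exp (-y) := by push_cast; ring
      _ ≤ Real.exp y * Real.exp (-y) := by gcongr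
      _ = 1 := by rw [← Real.exp_add]; simp

lemma exists_mul_rpow_le_of_rpow_le_sub {r : ℝ} (hr : 0 < r) {D : ℕ → ℝ≥0∞} (hD : Antitone D)
    (hD0 : D 0 ≠ ∞) {K : ℝ≥0∞} (hK : K ≠ ∞) (h : ∀ n, D n ^ (1 + r) ≤ K * (D n - D (n + 1))) :
    ∃ K' : ℝ≥0∞, K' ≠ ∞ ∧ ∀ n : ℕ, (n : ℝ≥0∞) * D n ^ r ≤ K' := by
  have hfin : ∀ n, D n ≠ ∞ := fun n => ne_top_of_le_ne_top hD0 (hD (Nat.zero_le n))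
  -- The added `1` makes the constant invertible even when `K = 0`.
  set k : ℝ := K.toReal + 1 with hk
  have hk0 : 0 < k := by positivity
  have h' : ∀ n, k⁻¹ * (D n).toReal ^ (1 + r) ≤ (D n).toReal - (D (n + 1)).toReal := by
    intro n
    have h1 := ENNReal.toReal_mono (by finiteness [hfin n]) (h n)
    rw [ENNReal.toReal_mul, ← ENNReal.toReal_rpow,
      ENNReal.toReal_sub_of_le (hD (Nat.le_succ n)) (hfin n)] at h1
    have h2 : 0 ≤ (D n).toReal - (D (n + 1)).toReal :=
      sub_nonneg.2 (ENNReal.toReal_mono (hfin n) (hD (Nat.le_succ n)))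
    rw [inv_mul_le_iff₀ hk0]
    exact h1.trans (mul_le_mul_of_nonneg_right (by linarith) h2)
  have key := mul_rpow_le_of_rpow_le_sub hr (fun n => ENNReal.toReal_nonneg) h'
  refine ⟨ENNReal.ofReal (k / r), ENNReal.ofReal_ne_top, fun n => ?_⟩
  rw [← ENNReal.ofReal_toReal (a := (n : ℝ≥0∞) * D n ^ r)
    (by finiteness [hfin n])]
  refine ENNReal.ofReal_le_ofReal ?_
  rw [ENNReal.toReal_mul, ← ENNReal.toReal_rpow, ENNReal.toReal_natCast, le_div_iff₀ hr]
  have := key n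
  rw [mul_assoc, mul_assoc, mul_left_comm, inv_mul_le_iff₀ hk0] at this
  linarith

/-- Since `U` is nonincreasing, summing the decrements of `D` from `n` to `2n` gives `n U(2n)^(1+α)
≤ K D(n)`, and `D(n)` is `O(n^(-α))`. This transfers the `L^p` rate to `L^q`. -/
lemma exists_mul_le_of_rpow_le_sub {α : ℝ} (hα : 0 < α) {D U : ℕ → ℝ≥0∞} (hD : Antitone D)
    (hU : Antitone U) (hD0 : D 0 ≠ ∞) {K K₁ : ℝ≥0∞} (hK : K ≠ ∞) (hK₁ : K₁ ≠ ∞)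
    (h : ∀ n, U n ^ (1 + α) ≤ K * (D n - D (n + 1)))
    (hrate : ∀ n : ℕ, (n : ℝ≥0∞) * D n ^ (1 / α) ≤ K₁) :
    ∃ K' : ℝ≥0∞, K' ≠ ∞ ∧ ∀ n : ℕ, 1 ≤ n → (n : ℝ≥0∞) * U (2 * n) ≤ K' := by
  have hfin : ∀ n, D n ≠ ∞ := fun n => ne_top_of_le_ne_top hD0 (hD (Nat.zero_le n))
  refine ⟨(K * K₁ ^ α) ^ (1 / (1 + α)), by finiteness, fun n hn => ?_⟩
  -- Telescoping, with `K * D (n + m)` kept on the left to avoid truncated subtraction.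
  have htel : ∀ m : ℕ, (m : ℝ≥0∞) * U (n + m) ^ (1 + α) + K * D (n + m) ≤ K * D n := by
    intro m
    induction m with
    | zero => simp
    | succ m ih =>
      have h1 : U (n + (m + 1)) ^ (1 + α) ≤ U (n + m) ^ (1 + α) :=
        ENNReal.rpow_le_rpow (hU (by omega)) (by positivity)
      calc ((m + 1 : ℕ) : ℝ≥0∞) * U (n + (m + 1)) ^ (1 + α) + K * D (n + (m + 1))
          ≤ (m + 1 : ℕ) * U (n + m) ^ (1 + α) + K * D (n + (m + 1)) := by gcongr
        _ = m * U (n + m) ^ (1 + α) + (U (n + m) ^ (1 + α) + K * D (n + m + 1)) := by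
            push_cast; rw [← add_assoc n m 1]; ring
        _ ≤ m * U (n + m) ^ (1 + α) + (K * (D (n + m) - D (n + m + 1)) + K * D (n + m + 1)) := by
            gcongr; exact h _
        _ = m * U (n + m) ^ (1 + α) + K * D (n + m) := by
            rw [← mul_add, tsub_add_cancel_of_le (hD (Nat.le_succ _))]
        _ ≤ _ := ih
  have h2 : (n : ℝ≥0∞) * U (2 * n) ^ (1 + α) ≤ K * D n := by
    rw [two_mul]; exact le_self_add.trans (htel n)
  have h3 : (n : ℝ≥0∞) ^ α * D n ≤ K₁ ^ α := by
    have := ENNReal.rpow_le_rpow (hrate n) hα.le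
    rwa [ENNReal.mul_rpow_of_nonneg _ _ hα.le, ← ENNReal.rpow_mul, one_div_mul_cancel hα.ne',
      ENNReal.rpow_one] at this
  have h4 : ((n : ℝ≥0∞) * U (2 * n)) ^ (1 + α) ≤ K * K₁ ^ α := by
    rw [ENNReal.mul_rpow_of_nonneg _ _ (by positivity),
      ENNReal.rpow_add_of_nonneg _ _ zero_le_one hα.le, ENNReal.rpow_one]
    calc (n : ℝ≥0∞) * n ^ α * U (2 * n) ^ (1 + α) = n ^ α * (n * U (2 * n) ^ (1 + α)) := by ring
      _ ≤ n ^ α * (K * D n) := by gcongr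
      _ = K * (n ^ α * D n) := by ring
      _ ≤ _ := by gcongr
  rw [one_div, ENNReal.le_rpow_inv_iff (by positivity)]
  exact h4

variable {E : Type*} [NormedAddCommGroup E] [NormedSpace ℝ E] [FiniteDimensional ℝ E]
  [Nontrivial E] [MeasurableSpace E] [BorelSpace E]

/-! ### The recursive inequality for greedy sequences. -/

omit [Nontrivial E] in
-- The small-ball bound is only needed for `ρ ≤ ‖ξ‖ + ‖a 0‖`, because `a 0` lies in every nonempty
-- grid. The index starts at `N + 1` because the distance to the empty grid is infinite.
lemma IsGreedyOptimal.lintegral_weight_mul_le {p : ℝ} (hp : 0 < p) {μ : Measure E}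
    [SFinite μ] {a : ℕ → E} (ha : IsGreedyOptimal p μ a)
    (hfin : distortion p μ (grid a 1) ≠ ∞) (ν : Measure E) [IsFiniteMeasure ν] {c : ℝ}
    (hc0 : 0 ≤ c) (hc1 : c < 1) {g : E → ℝ≥0∞}
    (hg : ∀ᵐ ξ ∂μ, ∀ ρ : ℝ, 0 ≤ ρ → ρ ≤ ‖ξ‖ + ‖a 0‖ →
      g ξ * ENNReal.ofReal (ρ ^ Module.finrank ℝ E) ≤ ν (Metric.closedBall ξ (c * ρ))) :
    ∃ K : ℝ≥0∞, K ≠ ∞ ∧ ∀ N : ℕ,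
      ∫⁻ ξ, g ξ * Metric.infEDist ξ (grid a (N + 1)) ^ (p + Module.finrank ℝ E) ∂μ ≤
        K * (distortion p μ (grid a (N + 1)) - distortion p μ (grid a (N + 2))) := by
  have hc : ENNReal.ofReal c < 1 := by simpa using hc1
  have hcp : ENNReal.ofReal c ^ p < 1 := ENNReal.rpow_lt_one hc hp
  have hcp0 : 1 - ENNReal.ofReal c ^ p ≠ 0 := (tsub_pos_of_lt hcp).ne'
  refine ⟨(1 - ENNReal.ofReal c ^ p)⁻¹ * ν Set.univ,
    ENNReal.mul_ne_top (ENNReal.inv_ne_top.2 hcp0) (measure_ne_top _ _), fun N => ?_⟩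
  have h := lintegral_measure_mul_infEDist_rpow_le (ν := ν) hp hc
    (Γ := grid a (N + 1)) (D := distortion p μ (grid a (N + 2)))
    (ne_top_of_le_ne_top hfin (distortion_anti hp μ (grid_mono a (by omega))))
    (fun y => ha.distortion_le hp (N + 1) y)
  rw [mul_assoc, mul_comm _⁻¹, ← div_eq_mul_inv,
    ENNReal.le_div_iff_mul_le (Or.inl hcp0) (Or.inl (by finiteness)), mul_comm]
  refine le_trans (mul_le_mul' le_rfl ?_) h
  refine lintegral_mono_ae ?_
  filter_upwards [hg] with ξ hξ
  have hmem : a 0 ∈ grid a (N + 1) := ⟨0, by simp, rfl⟩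
  have hle : Metric.infEDist ξ (grid a (N + 1)) ≤ edist ξ (a 0) :=
    Metric.infEDist_le_edist_of_mem hmem
  have hne : Metric.infEDist ξ (grid a (N + 1)) ≠ ∞ := ne_top_of_le_ne_top (edist_ne_top _ _) hle
  have hρ : (Metric.infEDist ξ (grid a (N + 1))).toReal ≤ ‖ξ‖ + ‖a 0‖ := by
    refine (ENNReal.toReal_mono (edist_ne_top _ _) hle).trans ?_
    rw [← dist_edist, dist_eq_norm]
    exact norm_sub_le _ _
  have h1 := hξ _ ENNReal.toReal_nonneg hρ
  rw [ENNReal.ofReal_pow ENNReal.toReal_nonneg, ENNReal.ofReal_toReal hne,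
    ← ENNReal.rpow_natCast] at h1
  rw [add_comm p, ENNReal.rpow_add_of_nonneg _ _ (by positivity) hp.le, ← mul_assoc]
  gcongr
  refine h1.trans (measure_mono fun y hy => ?_)
  rw [Metric.mem_closedBall] at hy
  change edist y ξ ≤ _
  rw [edist_dist, ← ENNReal.ofReal_toReal hne, ← ENNReal.ofReal_mul hc0]
  exact ENNReal.ofReal_le_ofReal hy

omit [Nontrivial E] in
lemma IsGreedyOptimal.distortion_rpow_le {p : ℝ} (hp : 0 < p) {μ : Measure E}
    [SFinite μ] {a : ℕ → E} (ha : IsGreedyOptimal p μ a)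
    (hfin : distortion p μ (grid a 1) ≠ ∞) {q : ℝ} (hq : 0 < q) (hqt : q < p + Module.finrank ℝ E)
    (ν : Measure E) [IsFiniteMeasure ν] {c : ℝ}
    (hc0 : 0 ≤ c) (hc1 : c < 1) {g : E → ℝ≥0∞} (hgm : Measurable g)
    (hg0 : ∀ᵐ ξ ∂μ, g ξ ≠ 0) (hg1 : ∀ᵐ ξ ∂μ, g ξ ≠ ∞)
    (hg : ∀ᵐ ξ ∂μ, ∀ ρ : ℝ, 0 ≤ ρ → ρ ≤ ‖ξ‖ + ‖a 0‖ →
      g ξ * ENNReal.ofReal (ρ ^ Module.finrank ℝ E) ≤ ν (Metric.closedBall ξ (c * ρ)))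
    (hW : ∫⁻ ξ, g ξ ^ (-(q / (p + Module.finrank ℝ E - q))) ∂μ ≠ ∞) :
    ∃ K : ℝ≥0∞, K ≠ ∞ ∧ ∀ N : ℕ,
      distortion q μ (grid a (N + 1)) ^ ((p + Module.finrank ℝ E) / q) ≤
        K * (distortion p μ (grid a (N + 1)) - distortion p μ (grid a (N + 2))) := by
  obtain ⟨K, hK, h⟩ := ha.lintegral_weight_mul_le hp hfin ν hc0 hc1 hg
  have htq : 0 < p + Module.finrank ℝ E - q := sub_pos.2 hqt
  refine ⟨(∫⁻ ξ, g ξ ^ (-(q / (p + Module.finrank ℝ E - q))) ∂μ) ^ ((p + Module.finrank ℝ E - q) / q) * K,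
    ENNReal.mul_ne_top (ENNReal.rpow_ne_top_of_nonneg (by positivity) hW) hK, fun N => ?_⟩
  refine (lintegral_rpow_le_of_weight μ hq hqt measurable_infEDist hgm hg0 hg1).trans ?_
  rw [mul_assoc]
  gcongr
  exact h N


omit [BorelSpace E] in
lemma exists_mul_distortion_le {p : ℝ} (hp : 0 < p) {μ : Measure E}
    {a : ℕ → E} (hfin : distortion p μ (grid a 1) ≠ ∞) {K : ℝ≥0∞} (hK : K ≠ ∞)
    (h : ∀ N : ℕ, distortion p μ (grid a (N + 1)) ^ ((p + Module.finrank ℝ E) / p) ≤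
      K * (distortion p μ (grid a (N + 1)) - distortion p μ (grid a (N + 2)))) :
    ∃ K' : ℝ≥0∞, K' ≠ ∞ ∧ ∀ n : ℕ, (n : ℝ≥0∞) *
      distortion p μ (grid a (n + 1)) ^ ((Module.finrank ℝ E : ℝ) / p) ≤ K' := by
  have hd : 0 < (Module.finrank ℝ E : ℝ) := by exact_mod_cast Module.finrank_pos
  refine exists_mul_rpow_le_of_rpow_le_sub (div_pos hd hp)
    (D := fun n => distortion p μ (grid a (n + 1)))
    (fun m n hmn => distortion_anti hp μ (grid_mono a (by omega))) hfin hK fun n => ?_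
  rw [show 1 + (Module.finrank ℝ E : ℝ) / p = (p + Module.finrank ℝ E) / p by field_simp]
  exact h n

omit [BorelSpace E] in
lemma isRateOptimal_of_distortion_rpow_le {p q : ℝ} (hp : 0 < p) (hq : 0 < q) {μ : Measure E}
    {a : ℕ → E} (hfin : distortion p μ (grid a 1) ≠ ∞) {K K₁ : ℝ≥0∞} (hK : K ≠ ∞) (hK₁ : K₁ ≠ ∞)
    (h : ∀ N : ℕ, distortion q μ (grid a (N + 1)) ^ ((p + Module.finrank ℝ E) / q) ≤
      K * (distortion p μ (grid a (N + 1)) - distortion p μ (grid a (N + 2))))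
    (hrate : ∀ n : ℕ, (n : ℝ≥0∞) *
      distortion p μ (grid a (n + 1)) ^ ((Module.finrank ℝ E : ℝ) / p) ≤ K₁) :
    IsRateOptimal q μ a := by
  have hd : 0 < (Module.finrank ℝ E : ℝ) := by exact_mod_cast Module.finrank_pos
  have hU : Antitone fun n => distortion q μ (grid a (n + 1)) ^ ((Module.finrank ℝ E : ℝ) / q) :=
    fun m n hmn => ENNReal.rpow_le_rpow (distortion_anti hq μ (grid_mono a (by omega)))
      (by positivity)
  obtain ⟨K', hK', h'⟩ := exists_mul_le_of_rpow_le_sub (div_pos hp hd)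
    (D := fun n => distortion p μ (grid a (n + 1)))
    (fun m n hmn => distortion_anti hp μ (grid_mono a (by omega))) hU hfin hK hK₁
    -- With `U = D_q^(d/q)` and `α = p/d`, the power `U^(1+α)` is `D_q^((p+d)/q)`.
    (fun n => by
      rw [← ENNReal.rpow_mul, show (Module.finrank ℝ E : ℝ) / q * (1 + p / Module.finrank ℝ E) =
        (p + Module.finrank ℝ E) / q by field_simp; ring]
      exact h n)
    (fun n => by rw [one_div_div]; exact hrate n)
  -- The factor `4` absorbs the halving and the index shift: `N + 1 ≤ 4 * (N / 2)` once `N ≥ 2`.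
  refine isRateOptimal_of_mul_distortion_le (K := 4 * K') (by finiteness) ?_
  filter_upwards [eventually_ge_atTop 3] with N hN
  obtain ⟨N, rfl⟩ : ∃ m, N = m + 1 := ⟨N - 1, by omega⟩
  calc ((N + 1 : ℕ) : ℝ≥0∞) * distortion q μ (grid a (N + 1)) ^ ((Module.finrank ℝ E : ℝ) / q)
      ≤ (4 * (N / 2) : ℕ) *
        distortion q μ (grid a (2 * (N / 2) + 1)) ^ ((Module.finrank ℝ E : ℝ) / q) := by
        gcongr ?_ * ?_
        · exact_mod_cast (by omega : N + 1 ≤ 4 * (N / 2))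
        · exact hU (by omega : 2 * (N / 2) ≤ N)
    _ = 4 * ((N / 2 : ℕ) *
        distortion q μ (grid a (2 * (N / 2) + 1)) ^ ((Module.finrank ℝ E : ℝ) / q)) := by
        rw [Nat.cast_mul, mul_assoc]; rfl
    _ ≤ 4 * K' := by gcongr; exact h' _ (by omega)

/-! ### Moments and lower bounds for the mass of small balls. -/

omit [NormedSpace ℝ E] [FiniteDimensional ℝ E] [Nontrivial E] [BorelSpace E] in
lemma lintegral_one_add_norm_rpow_ne_top {μ : Measure E} [IsFiniteMeasure μ] {s : ℝ} (hs : 0 < s)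
    (h : ∫⁻ ξ, ENNReal.ofReal (‖ξ‖ ^ s) ∂μ < ∞) :
    ∫⁻ ξ, ENNReal.ofReal ((1 + ‖ξ‖) ^ s) ∂μ ≠ ∞ := by
  have hle : ∀ ξ : E, ENNReal.ofReal ((1 + ‖ξ‖) ^ s) ≤
      ENNReal.ofReal (2 ^ s) * (1 + ENNReal.ofReal (‖ξ‖ ^ s)) := by
    intro ξ
    rw [← ENNReal.ofReal_one, ← ENNReal.ofReal_add zero_le_one (by positivity),
      ← ENNReal.ofReal_mul (by positivity)]
    refine ENNReal.ofReal_le_ofReal ?_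
    rcases le_total ‖ξ‖ 1 with h1 | h1
    · calc (1 + ‖ξ‖) ^ s ≤ 2 ^ s * 1 := by
            rw [mul_one]; exact Real.rpow_le_rpow (by positivity) (by linarith) hs.le
        _ ≤ _ := by gcongr; linarith [Real.rpow_nonneg (norm_nonneg ξ) s]
    · calc (1 + ‖ξ‖) ^ s ≤ (2 * ‖ξ‖) ^ s :=
            Real.rpow_le_rpow (by positivity) (by linarith) hs.le
        _ = 2 ^ s * ‖ξ‖ ^ s := Real.mul_rpow (by norm_num) (norm_nonneg _)
        _ ≤ _ := by gcongr; linarith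
  refine ne_top_of_le_ne_top ?_ (lintegral_mono hle)
  rw [lintegral_const_mul' _ _ ENNReal.ofReal_ne_top, lintegral_add_left measurable_const]
  refine ENNReal.mul_ne_top ENNReal.ofReal_ne_top (ENNReal.add_ne_top.2 ⟨?_, h.ne⟩)
  simp

omit [Nontrivial E] in
/-- A density bounded below on part of a ball that fills a given proportion of it. -/
lemma le_withDensity_closedBall (lam : Measure E) [lam.IsAddHaarMeasure] {f : E → ℝ≥0∞}
    {S : Set E} (hS : MeasurableSet S) {ξ : E} {c ρ : ℝ} (hc : 0 ≤ c) (hρ : 0 ≤ ρ)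
    {κ m : ℝ≥0∞}
    (hκ : κ * lam (Metric.closedBall ξ (c * ρ)) ≤ lam (S ∩ Metric.closedBall ξ (c * ρ)))
    (hm : ∀ x ∈ S ∩ Metric.closedBall ξ (c * ρ), m ≤ f x) :
    κ * (ENNReal.ofReal (c ^ Module.finrank ℝ E) * lam (Metric.ball 0 1)) * m *
      ENNReal.ofReal (ρ ^ Module.finrank ℝ E) ≤
      lam.withDensity f (Metric.closedBall ξ (c * ρ)) := by
  have hB : MeasurableSet (S ∩ Metric.closedBall ξ (c * ρ)) :=
    hS.inter Metric.isClosed_closedBall.measurableSet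
  calc _ = m * (κ * lam (Metric.closedBall ξ (c * ρ))) := by
        rw [Measure.addHaar_closedBall _ _ (by positivity), mul_pow,
          ENNReal.ofReal_mul (by positivity)]
        ring
    _ ≤ m * lam (S ∩ Metric.closedBall ξ (c * ρ)) := by gcongr
    _ = ∫⁻ _ in S ∩ Metric.closedBall ξ (c * ρ), m ∂lam := by rw [setLIntegral_const]
    _ ≤ ∫⁻ x in S ∩ Metric.closedBall ξ (c * ρ), f x ∂lam := setLIntegral_mono' hB hm
    _ = lam.withDensity f (S ∩ Metric.closedBall ξ (c * ρ)) := (withDensity_apply _ hB).symm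
    _ ≤ _ := measure_mono Set.inter_subset_right

omit [Nontrivial E] in
lemma exists_le_withDensity_one_add_norm (lam : Measure E) [lam.IsAddHaarMeasure] {r : ℝ}
    (hr : 0 ≤ r) {R c : ℝ} (hR : 0 ≤ R) (hc0 : 0 < c) (hc1 : c ≤ 1) :
    ∃ k : ℝ≥0∞, k ≠ 0 ∧ k ≠ ∞ ∧ ∀ (ξ : E) (ρ : ℝ), 0 ≤ ρ → ρ ≤ ‖ξ‖ + R →
      k * ENNReal.ofReal ((1 + ‖ξ‖) ^ (-r)) * ENNReal.ofReal (ρ ^ Module.finrank ℝ E) ≤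
        lam.withDensity (fun x => ENNReal.ofReal ((1 + ‖x‖) ^ (-r)))
          (Metric.closedBall ξ (c * ρ)) := by
  have hball0 : lam (Metric.ball (0 : E) 1) ≠ 0 := (Metric.measure_ball_pos lam 0 one_pos).ne'
  have hball : lam (Metric.ball (0 : E) 1) ≠ ∞ := measure_ball_lt_top.ne
  refine ⟨ENNReal.ofReal (c ^ Module.finrank ℝ E) * lam (Metric.ball 0 1) *
    ENNReal.ofReal ((2 + R) ^ (-r)), ?_, by finiteness, fun ξ ρ h0 h1 => ?_⟩
  · refine mul_ne_zero (mul_ne_zero ?_ hball0) ?_ <;>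
    · rw [← pos_iff_ne_zero, ENNReal.ofReal_pos]; positivity
  -- On the ball, `1 + ‖x‖ ≤ 1 + 2‖ξ‖ + R ≤ (2 + R)(1 + ‖ξ‖)`.
  · have := le_withDensity_closedBall lam (f := fun x => ENNReal.ofReal ((1 + ‖x‖) ^ (-r)))
      MeasurableSet.univ (ξ := ξ) (m := ENNReal.ofReal (((2 + R) * (1 + ‖ξ‖)) ^ (-r)))
      (κ := 1) hc0.le h0 (by simp) ?_
    · refine le_trans (le_of_eq ?_) this
      rw [Real.mul_rpow (by positivity) (by positivity), ENNReal.ofReal_mul (by positivity)]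
      ring
    · rintro x ⟨-, hx⟩
      refine ENNReal.ofReal_le_ofReal (Real.rpow_le_rpow_of_nonpos (by positivity) ?_ (by linarith))
      rw [Metric.mem_closedBall, dist_eq_norm] at hx
      have h2 : ‖x‖ ≤ ‖x - ξ‖ + ‖ξ‖ := by simpa using norm_add_le (x - ξ) ξ
      have h3 : c * ρ ≤ ρ := mul_le_of_le_one_left h0 hc1
      nlinarith [norm_nonneg ξ, mul_nonneg hR (norm_nonneg ξ)]

lemma exists_le_withDensity_of_localGrowthControl (lam : Measure E) [lam.IsAddHaarMeasure]
    {μ : Measure E} (hpeak : IsPeakless lam μ) {φ : E → ℝ} (hφ0 : ∀ ξ, 0 ≤ φ ξ) {ε : ℝ}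
    (hG : LocalGrowthControl μ φ ε) {s R : ℝ} (hs : 0 ≤ s) :
    ∃ (c L : ℝ) (k : ℝ≥0∞), 0 < c ∧ c < 1 ∧ k ≠ 0 ∧ k ≠ ∞ ∧
      ∀ ξ ∈ μ.support, L ≤ ‖ξ‖ → ∀ ρ : ℝ, 0 ≤ ρ → ρ ≤ ‖ξ‖ + R →
      k * ENNReal.ofReal (φ ξ ^ ((1 + ε) * s)) * ENNReal.ofReal (ρ ^ Module.finrank ℝ E) ≤
        lam.withDensity (fun x => ENNReal.ofReal (φ x ^ s)) (Metric.closedBall ξ (c * ρ)) := by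
  obtain ⟨b, hb, hinf⟩ := hpeak
  obtain ⟨η, M, C, hη, hη2, hM, hC, hgrow⟩ := hG
  set κ := ⨅ ξ ∈ μ.support, ⨅ ρ ∈ Set.Ioc (0 : ℝ) (b * ‖ξ‖),
      lam (μ.support ∩ Metric.closedBall ξ ρ) / lam (Metric.closedBall ξ ρ) with hκ
  have hball0 : lam (Metric.ball (0 : E) 1) ≠ 0 := (Metric.measure_ball_pos lam 0 one_pos).ne'
  have hball : lam (Metric.ball (0 : E) 1) ≠ ∞ := measure_ball_lt_top.ne
  -- Once `‖ξ‖ ≥ R`, one has `ρ ≤ 2‖ξ‖`, so `c ρ` is within both the growth radius `2η‖ξ‖` and the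
  -- peakless radius `b‖ξ‖`.
  set c : ℝ := min η (b / 2) with hcdef
  have hc0 : 0 < c := lt_min hη (by positivity)
  have hcη : c ≤ η := min_le_left _ _
  have hcb : c ≤ b / 2 := min_le_right _ _
  -- The infimum `κ` is `∞` when its index set is empty; `min κ 1` keeps the constant finite.
  refine ⟨c, max M R, min κ 1 * (ENNReal.ofReal (c ^ Module.finrank ℝ E) *
    lam (Metric.ball 0 1)) * ENNReal.ofReal (C ^ s), hc0, by linarith, ?_, ?_, ?_⟩
  · refine mul_ne_zero (mul_ne_zero (lt_min hinf one_pos).ne' (mul_ne_zero ?_ hball0)) ?_ <;>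
    · rw [← pos_iff_ne_zero, ENNReal.ofReal_pos]; positivity
  · have : min κ 1 ≠ ∞ := ne_top_of_le_ne_top ENNReal.one_ne_top (min_le_right _ _)
    finiteness
  · intro ξ hξ hL ρ hρ0 hρ
    have hMξ : M ≤ ‖ξ‖ := (le_max_left _ _).trans hL
    have hRξ : R ≤ ‖ξ‖ := (le_max_right _ _).trans hL
    rcases hρ0.eq_or_lt with rfl | hρpos
    · simp [zero_pow (Module.finrank_pos (R := ℝ) (M := E)).ne']
    have hcρη : c * ρ ≤ 2 * η * ‖ξ‖ := by
      calc c * ρ ≤ η * (2 * ‖ξ‖) := by gcongr; linarith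
        _ = _ := by ring
    have hcρb : c * ρ ≤ b * ‖ξ‖ := by
      calc c * ρ ≤ b / 2 * (2 * ‖ξ‖) := by gcongr; linarith
        _ = _ := by ring
    have hκ' : min κ 1 * lam (Metric.closedBall ξ (c * ρ)) ≤
        lam (μ.support ∩ Metric.closedBall ξ (c * ρ)) := by
      refine ENNReal.mul_le_of_le_div ((min_le_left _ _).trans ?_)
      exact (iInf₂_le ξ hξ).trans (iInf₂_le (c * ρ) ⟨by positivity, hcρb⟩)
    have := le_withDensity_closedBall lam (f := fun x => ENNReal.ofReal (φ x ^ s))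
      Measure.isClosed_support.measurableSet (m := ENNReal.ofReal ((C * φ ξ ^ (1 + ε)) ^ s))
      hc0.le hρ0 hκ' ?_
    · refine le_trans (le_of_eq ?_) this
      rw [Real.mul_rpow hC.le (Real.rpow_nonneg (hφ0 _) _), ← Real.rpow_mul (hφ0 _),
        ENNReal.ofReal_mul (by positivity)]
      ring
    · rintro x ⟨hx, hxB⟩
      refine ENNReal.ofReal_le_ofReal (Real.rpow_le_rpow ?_ (hgrow ξ hξ x hx hMξ ?_) hs)
      · exact mul_nonneg hC.le (Real.rpow_nonneg (hφ0 _) _)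
      · rw [← dist_eq_norm]
        exact (Metric.mem_closedBall.1 hxB).trans hcρη

omit [NormedSpace ℝ E] [FiniteDimensional ℝ E] [Nontrivial E] [BorelSpace E] in
-- The first greedy point does at least as well as the origin.
lemma IsGreedyOptimal.distortion_ne_top {p : ℝ} (hp : 0 < p) {μ : Measure E}
    {a : ℕ → E} (ha : IsGreedyOptimal p μ a) {s : ℝ} (hps : p ≤ s)
    (h : ∫⁻ ξ, ENNReal.ofReal ((1 + ‖ξ‖) ^ s) ∂μ ≠ ∞) : distortion p μ (grid a 1) ≠ ∞ := by
  refine ne_top_of_le_ne_top h ((ha.distortion_le hp 0 0).trans (lintegral_mono fun ξ => ?_))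
  have : grid a 0 = ∅ := by simp [grid]
  dsimp only
  rw [this, Set.empty_union, Metric.infEDist_singleton, edist_zero_right, ← ofReal_norm,
    ENNReal.ofReal_rpow_of_nonneg (norm_nonneg _) hp.le]
  refine ENNReal.ofReal_le_ofReal ?_
  calc ‖ξ‖ ^ p ≤ (1 + ‖ξ‖) ^ p := Real.rpow_le_rpow (norm_nonneg _) (by linarith) hp.le
    _ ≤ (1 + ‖ξ‖) ^ s := Real.rpow_le_rpow_of_exponent_le (by linarith [norm_nonneg ξ]) hps

omit [Nontrivial E] in
lemma isFiniteMeasure_withDensity_one_add_norm (lam : Measure E) [lam.IsAddHaarMeasure] {r : ℝ}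
    (hr : Module.finrank ℝ E < r) :
    IsFiniteMeasure (lam.withDensity fun x => ENNReal.ofReal ((1 + ‖x‖) ^ (-r))) :=
  isFiniteMeasure_withDensity (finite_integral_one_add_norm hr).ne

/-! ### The `L^p` rate. -/

/-- Greedy sequences are rate optimal in the `L^p` sense as soon as a moment of order greater than
`p` is finite. -/
lemma IsGreedyOptimal.exists_rate {p : ℝ} (hp : 0 < p) (lam : Measure E) [lam.IsAddHaarMeasure]
    {μ : Measure E} [IsFiniteMeasure μ] {a : ℕ → E} (ha : IsGreedyOptimal p μ a) {δ : ℝ}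
    (hδ : 0 < δ) (h : ∫⁻ ξ, ENNReal.ofReal ((1 + ‖ξ‖) ^ (p + δ)) ∂μ ≠ ∞) :
    ∃ K : ℝ≥0∞, K ≠ ∞ ∧ ∀ n : ℕ, (n : ℝ≥0∞) *
      distortion p μ (grid a (n + 1)) ^ ((Module.finrank ℝ E : ℝ) / p) ≤ K := by
  have hd : 0 < (Module.finrank ℝ E : ℝ) := by exact_mod_cast Module.finrank_pos
  -- Chosen so that the Hölder power `-p/d` of `(1+‖ξ‖)^(-r)` is exactly `(1+‖ξ‖)^(p+δ)`; as `δ >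
  -- 0`, also `r > d`, so `ν` is finite.
  set r : ℝ := (p + δ) * Module.finrank ℝ E / p with hr
  have hdr : Module.finrank ℝ E < r := by rw [hr, lt_div_iff₀ hp]; nlinarith
  have hfin := ha.distortion_ne_top hp (by linarith) h
  have := isFiniteMeasure_withDensity_one_add_norm lam hdr
  obtain ⟨k, hk0, hk1, hk⟩ := exists_le_withDensity_one_add_norm lam (hd.le.trans hdr.le)
    (norm_nonneg (a 0)) (c := 1 / 2) (by norm_num) (by norm_num)
  obtain ⟨K, hK, hrec⟩ := ha.distortion_rpow_le hp hfin hp (by linarith) _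
    (c := 1 / 2) (by norm_num) (by norm_num)
    (g := fun ξ => k * ENNReal.ofReal ((1 + ‖ξ‖) ^ (-r))) (by fun_prop)
    (Eventually.of_forall fun ξ => mul_ne_zero hk0
      (by rw [← pos_iff_ne_zero, ENNReal.ofReal_pos]; positivity))
    (Eventually.of_forall fun ξ => by finiteness)
    (Eventually.of_forall hk) (by
      have : ∀ ξ : E, (k * ENNReal.ofReal ((1 + ‖ξ‖) ^ (-r))) ^
          (-(p / (p + Module.finrank ℝ E - p))) =
          k ^ (-(p / (p + Module.finrank ℝ E - p))) * ENNReal.ofReal ((1 + ‖ξ‖) ^ (p + δ)) := by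
        intro ξ
        rw [ENNReal.mul_rpow_of_ne_top hk1 ENNReal.ofReal_ne_top,
          ENNReal.ofReal_rpow_of_pos (by positivity), ← Real.rpow_mul (by positivity)]
        congr 3
        rw [hr, add_sub_cancel_left]
        field_simp
      simp_rw [this]
      rw [lintegral_const_mul' _ _ (ENNReal.rpow_ne_top_of_ne_zero hk0 hk1)]
      exact ENNReal.mul_ne_top (ENNReal.rpow_ne_top_of_ne_zero hk0 hk1) h)
  exact exists_mul_distortion_le hp hfin hK hrec

/-! ### Integrals of powers of the density. -/

section DensityPowers

variable {α : Type*} [MeasurableSpace α] {lam : Measure α} {φ : α → ℝ}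

lemma lintegral_ofReal_rpow_eq_setLIntegral (hφm : Measurable φ) (hφ0 : ∀ x, 0 ≤ φ x) {s : ℝ}
    (hs : s ≠ 0) :
    ∫⁻ x, ENNReal.ofReal (φ x ^ s) ∂lam =
      ∫⁻ x in {x | 0 < φ x}, ENNReal.ofReal (φ x ^ s) ∂lam := by
  rw [← lintegral_indicator (measurableSet_lt measurable_const hφm)]
  refine lintegral_congr fun x => ?_
  rcases (hφ0 x).eq_or_lt with h | h
  · rw [Set.indicator_of_notMem (by simp [← h]), ← h, Real.zero_rpow hs, ENNReal.ofReal_zero]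
  · rw [Set.indicator_of_mem (by exact h)]

lemma ae_withDensity_pos (hφm : Measurable φ) :
    ∀ᵐ x ∂lam.withDensity (fun x => ENNReal.ofReal (φ x)), 0 < φ x := by
  rw [ae_withDensity_iff (by fun_prop)]
  exact Eventually.of_forall fun x hx => by simpa using hx

/-- The condition `u ≠ 1` makes both integrands vanish where `φ` does. -/
lemma lintegral_withDensity_ofReal_rpow (hφm : Measurable φ) (hφ0 : ∀ x, 0 ≤ φ x) {u : ℝ}
    (hu : u ≠ 1) :
    ∫⁻ x, ENNReal.ofReal (φ x ^ (-u)) ∂lam.withDensity (fun x => ENNReal.ofReal (φ x)) =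
      ∫⁻ x, ENNReal.ofReal (φ x ^ (1 - u)) ∂lam := by
  rw [lintegral_withDensity_eq_lintegral_mul _ (by fun_prop) (by fun_prop)]
  refine lintegral_congr fun x => ?_
  rw [Pi.mul_apply, ← ENNReal.ofReal_mul (hφ0 x), sub_eq_add_neg,
    Real.rpow_one_add' (hφ0 x) (by simpa [← sub_eq_add_neg, sub_eq_zero] using hu.symm)]

end DensityPowers

/-! ### The `L^q` rate and the theorem. -/

/-- `L^q`-rate optimality of the `L^p`-greedy sequences, for a density with local growth control. -/
lemma IsGreedyOptimal.isRateOptimal_of_localGrowthControl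
    (lam : Measure E) [lam.IsAddHaarMeasure]
    {φ : E → ℝ} (hφm : Measurable φ) (hφ0 : ∀ ξ, 0 ≤ φ ξ)
    {μ : Measure E} [IsProbabilityMeasure μ]
    (hμ : μ = lam.withDensity (fun ξ => ENNReal.ofReal (φ ξ)))
    {p : ℝ} (hp : 0 < p)
    (hmom : ∃ δ : ℝ, 0 < δ ∧ ∫⁻ ξ, ENNReal.ofReal (‖ξ‖ ^ (p + δ)) ∂μ < ∞)
    (hpeak : IsPeakless lam μ) {ε : ℝ} (hε : 0 ≤ ε) (hG : LocalGrowthControl μ φ ε)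
    {q : ℝ} (hq : 0 < q) (hqt : q * (1 + ε) < p + Module.finrank ℝ E)
    (hint : ∫⁻ ξ in {ξ | 0 < φ ξ},
      ENNReal.ofReal (φ ξ ^ (1 - q * (1 + ε) / (p + Module.finrank ℝ E))) ∂lam < ∞)
    {a : ℕ → E} (ha : IsGreedyOptimal p μ a) : IsRateOptimal q μ a := by
  obtain ⟨δ, hδ, hmom⟩ := hmom
  have hmom' := lintegral_one_add_norm_rpow_ne_top (by positivity) hmom
  have hfin := ha.distortion_ne_top hp (by linarith) hmom'
  obtain ⟨K₁, hK₁, hrate⟩ := ha.exists_rate hp lam hδ hmom'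
  have hd : 0 < (Module.finrank ℝ E : ℝ) := by exact_mod_cast Module.finrank_pos
  set t : ℝ := p + Module.finrank ℝ E with ht
  have ht0 : 0 < t := by positivity
  have hqt' : q < t := by nlinarith
  set u : ℝ := q * (1 + ε) / t with hu
  have hu1 : u < 1 := (div_lt_one ht0).2 hqt
  have hs0 : 0 < 1 - u := sub_pos.2 hu1
  rw [← lintegral_ofReal_rpow_eq_setLIntegral hφm hφ0 hs0.ne'] at hint
  -- Any exponent above `d` would do: this density only handles the bounded region `‖ξ‖ < L`, where
  -- growth control says nothing.
  set r : ℝ := Module.finrank ℝ E + 1 with hr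
  have := isFiniteMeasure_withDensity_one_add_norm lam (r := r) (by linarith)
  have : IsFiniteMeasure (lam.withDensity fun x => ENNReal.ofReal (φ x ^ (1 - u))) :=
    isFiniteMeasure_withDensity hint.ne
  obtain ⟨c, L, k₁, hc0, hc1, hk₁0, hk₁1, hk₁⟩ :=
    exists_le_withDensity_of_localGrowthControl lam hpeak hφ0 hG (R := ‖a 0‖) hs0.le
  obtain ⟨k₂, hk₂0, hk₂1, hk₂⟩ := exists_le_withDensity_one_add_norm lam (r := r) (by positivity)
    (norm_nonneg (a 0)) hc0 hc1.le
  have hφpos : ∀ᵐ ξ ∂μ, 0 < φ ξ := by rw [hμ]; exact ae_withDensity_pos hφm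
  set β : ℝ := q / (t - q) with hβ
  have htq : 0 < t - q := sub_pos.2 hqt'
  have hβ0 : 0 ≤ β := by positivity
  set g : E → ℝ≥0∞ := fun ξ => if L ≤ ‖ξ‖ then k₁ * ENNReal.ofReal (φ ξ ^ ((1 + ε) * (1 - u)))
    else k₂ * ENNReal.ofReal ((1 + ‖ξ‖) ^ (-r)) with hg
  have hgW : ∀ᵐ ξ ∂μ, g ξ ^ (-β) ≤ k₂ ^ (-β) * ENNReal.ofReal ((1 + |L|) ^ (r * β)) +
      k₁ ^ (-β) * (1 + ENNReal.ofReal (φ ξ ^ (-u))) := by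
    filter_upwards [hφpos] with ξ hξ
    simp only [hg]
    split_ifs with hL
    · refine le_add_left ?_
      rw [ENNReal.mul_rpow_of_ne_top hk₁1 ENNReal.ofReal_ne_top,
        ENNReal.ofReal_rpow_of_pos (by positivity), ← Real.rpow_mul hξ.le]
      gcongr
      rw [← ENNReal.ofReal_one, ← ENNReal.ofReal_add zero_le_one (by positivity)]
      refine ENNReal.ofReal_le_ofReal ?_
      -- This reduces to `(1 - u) t = t - q (1 + ε) ≤ t - q`. Hence the negative power of `φ` is at
      -- most `φ^(-u)` where `φ ≤ 1`, and at most `1` where `φ ≥ 1`.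
      have hexp : (1 + ε) * (1 - u) * β ≤ u := by
        have h1 : (1 - u) * t ≤ t - q := by
          rw [hu, sub_mul, div_mul_cancel₀ _ ht0.ne']; nlinarith
        rw [hβ, hu, ← mul_div_assoc, div_le_div_iff₀ htq ht0]
        calc (1 + ε) * (1 - u) * q * t = (q * (1 + ε)) * ((1 - u) * t) := by ring
          _ ≤ (q * (1 + ε)) * (t - q) := by gcongr
      have hexp0 : 0 ≤ (1 + ε) * (1 - u) * β := by positivity
      rcases le_total 1 (φ ξ) with h1 | h1
      · have := Real.rpow_le_one_of_one_le_of_nonpos h1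
          (z := (1 + ε) * (1 - u) * -β) (by linarith)
        linarith [Real.rpow_nonneg hξ.le (-u)]
      · have := Real.rpow_le_rpow_of_exponent_ge hξ h1
          (show -u ≤ (1 + ε) * (1 - u) * -β by linarith)
        linarith
    · refine le_add_right ?_
      rw [ENNReal.mul_rpow_of_ne_top hk₂1 ENNReal.ofReal_ne_top,
        ENNReal.ofReal_rpow_of_pos (by positivity), ← Real.rpow_mul (by positivity), neg_mul_neg]
      gcongr
      exact (not_le.1 hL).le.trans (le_abs_self L)
  obtain ⟨K, hK, hrec⟩ := ha.distortion_rpow_le hp hfin hq hqt'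
    (lam.withDensity (fun x => ENNReal.ofReal (φ x ^ (1 - u))) +
      lam.withDensity fun x => ENNReal.ofReal ((1 + ‖x‖) ^ (-r)))
    hc0.le hc1 (g := g)
    (Measurable.ite (measurableSet_le measurable_const measurable_norm) (by fun_prop)
      (by fun_prop))
    (by
      filter_upwards [hφpos] with ξ hξ
      simp only [hg]
      split_ifs
      · refine mul_ne_zero hk₁0 ?_
        rw [← pos_iff_ne_zero, ENNReal.ofReal_pos]; positivity
      · refine mul_ne_zero hk₂0 ?_
        rw [← pos_iff_ne_zero, ENNReal.ofReal_pos]; positivity)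
    (Eventually.of_forall fun ξ => by
      simp only [hg]
      split_ifs <;> finiteness)
    (by
      filter_upwards [Measure.support_mem_ae (μ := μ)] with ξ hξ ρ hρ0 hρ
      rw [Measure.add_apply]
      simp only [hg]
      split_ifs with hL
      · exact le_add_right (hk₁ ξ hξ hL ρ hρ0 hρ)
      · exact le_add_left (hk₂ ξ ρ hρ0 hρ))
    (by
      refine ne_top_of_le_ne_top ?_ (lintegral_mono_ae hgW)
      have h1 : k₁ ^ (-β) ≠ ∞ := ENNReal.rpow_ne_top_of_ne_zero hk₁0 hk₁1
      have h2 : k₂ ^ (-β) ≠ ∞ := ENNReal.rpow_ne_top_of_ne_zero hk₂0 hk₂1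
      rw [lintegral_add_left measurable_const, lintegral_const_mul' _ _ h1,
        lintegral_add_left measurable_const, lintegral_const, lintegral_const, measure_univ,
        hμ, lintegral_withDensity_ofReal_rpow hφm hφ0 hu1.ne]
      finiteness [hint.ne])
  exact isRateOptimal_of_distortion_rpow_le hp hq hfin hK hK₁ hrec hrate

end GreedyQuantization

open GreedyQuantization in
theorem mainTheorem7
    {E : Type*} [NormedAddCommGroup E] [NormedSpace ℝ E] [FiniteDimensional ℝ E] [Nontrivial E]
    [MeasurableSpace E] [BorelSpace E]
    (lam : Measure E) [lam.IsAddHaarMeasure]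
    (φ : E → ℝ) (hφm : Measurable φ) (hφ0 : ∀ ξ, 0 ≤ φ ξ)
    (μ : Measure E) [IsProbabilityMeasure μ]
    (hμ : μ = lam.withDensity (fun ξ => ENNReal.ofReal (φ ξ)))
    (p : ℝ) (hp : 0 < p)
    (hmom : ∃ δ : ℝ, 0 < δ ∧ ∫⁻ ξ, ENNReal.ofReal (‖ξ‖ ^ (p + δ)) ∂μ < ∞)
    (hpeak : IsPeakless lam μ) :
    (∀ ε : ℝ, 0 ≤ ε → LocalGrowthControl μ φ ε →
      ∀ q : ℝ, 0 < q → q < (p + Module.finrank ℝ E) / (1 + ε) →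
        ∫⁻ ξ in {ξ | 0 < φ ξ},
          ENNReal.ofReal (φ ξ ^ (1 - q * (1 + ε) / (p + Module.finrank ℝ E))) ∂lam < ∞ →
        ∀ a : ℕ → E, IsGreedyOptimal p μ a → IsRateOptimal q μ a) ∧
    ((LocalGrowthControl μ φ 0 ∨
        ∃ ε₀ : ℝ, 0 < ε₀ ∧ ∀ ε : ℝ, 0 < ε → ε ≤ ε₀ → LocalGrowthControl μ φ ε) →
      (∀ q : ℝ, 0 < q → q < p + Module.finrank ℝ E →
        ∫⁻ ξ in {ξ | 0 < φ ξ},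
          ENNReal.ofReal (φ ξ ^ (1 - q / (p + Module.finrank ℝ E))) ∂lam < ∞) →
      ∀ q : ℝ, p < q → q < p + Module.finrank ℝ E →
        ∀ a : ℕ → E, IsGreedyOptimal p μ a → IsRateOptimal q μ a) := by
  refine ⟨fun ε hε hG q hq hqt hint a ha => ?_, fun hG hint q hpq hqt a ha => ?_⟩
  · exact ha.isRateOptimal_of_localGrowthControl lam hφm hφ0 hμ hp hmom hpeak hε hG hq
      ((lt_div_iff₀ (by positivity)).1 hqt) hint
  · have hq : 0 < q := hp.trans hpq
    obtain ⟨ε, hε, hGε, hqε⟩ : ∃ ε : ℝ, 0 ≤ ε ∧ LocalGrowthControl μ φ ε ∧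
        q * (1 + ε) < p + Module.finrank ℝ E := by
      rcases hG with hG | ⟨ε₀, hε₀, hG⟩
      · exact ⟨0, le_rfl, hG, by simpa using hqt⟩
      -- This cap on `ε` keeps `q(1+ε)` below the midpoint of `q` and `p+d`, so the integrability
      -- hypothesis applies at the exponent `q(1+ε)`.
      · have h1 : 0 < (p + Module.finrank ℝ E - q) / (2 * q) := by
          have := sub_pos.2 hqt
          positivity
        refine ⟨min ε₀ ((p + Module.finrank ℝ E - q) / (2 * q)), (lt_min hε₀ h1).le,
          hG _ (lt_min hε₀ h1) (min_le_left _ _), ?_⟩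
        calc q * (1 + min ε₀ ((p + Module.finrank ℝ E - q) / (2 * q)))
            ≤ q * (1 + (p + Module.finrank ℝ E - q) / (2 * q)) := by
              gcongr; exact min_le_right _ _
          _ = (p + Module.finrank ℝ E + q) / 2 := by field_simp; ring
          _ < p + Module.finrank ℝ E := by linarith
    exact ha.isRateOptimal_of_localGrowthControl lam hφm hφ0 hμ hp hmom hpeak hε hGε hq hqε
      (hint _ (by positivity) hqε)
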